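/- Let $n$ be a natural number, let $q\le 7$ be a prime, and let $V=\{0,v_1,\dots,v_{q-1}\}\subset\mathbb{Z}^n$ be a set with exactly $q$ elements such that $v_1,\dots,v_{q-1}$ generate the group $\mathbb{Z}^n$. Then every tiling of $\mathbb{Z}^n$ by translates of $V$ is a lattice tiling. That is, if $\mathcal{L}\subset\mathbb{Z}^n$ is such that every element of $\mathbb{Z}^n$ can be written in a unique way as $v+l$ with $v\in V$ and $l\in\mathcal{L}$, then $\mathcal{L}=a+\Lambda$ for some $a\in\mathbb{Z}^n$ and some lattice $\Lambda\subset\mathbb{Z}^n$ (a subgroup of finite index); in particular, if $0\in\mathcal{L}$, then $\mathcal{L}$ itself is a lattice. -/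

import Mathlib

open scoped Pointwise

/-- `L` is the set of translation vectors of a tiling of `ℤⁿ` by the translates `V + l`, `l ∈ L`:
every element of `ℤⁿ` is in a unique way a sum `v + l` with `v ∈ V` and `l ∈ L`. -/
def IsTranslationTiling {n : ℕ} (V L : Set (Fin n → ℤ)) : Prop :=
  ∀ x : Fin n → ℤ, ∃! p : (Fin n → ℤ) × (Fin n → ℤ), p.1 ∈ V ∧ p.2 ∈ L ∧ p.1 + p.2 = x

/-- This is Mathlib's notion of additive complements. -/
theorem isTranslationTiling_iff_isComplement {n : ℕ} (V L : Set (Fin n → ℤ)) :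
    IsTranslationTiling V L ↔ AddSubgroup.IsComplement V L := by
  rw [AddSubgroup.isComplement_iff_existsUnique]
  refine forall_congr' fun x => ⟨?_, ?_⟩
  · rintro ⟨p, ⟨h1, h2, h3⟩, hu⟩
    refine ⟨(⟨p.1, h1⟩, ⟨p.2, h2⟩), h3, ?_⟩
    rintro ⟨⟨a, ha⟩, ⟨b, hb⟩⟩ hab
    have := hu (a, b) ⟨ha, hb, hab⟩
    subst this
    rfl
  · rintro ⟨⟨⟨a, ha⟩, ⟨b, hb⟩⟩, hab, hu⟩
    refine ⟨(a, b), ⟨ha, hb, hab⟩, ?_⟩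
    rintro ⟨c, d⟩ ⟨hc, hd, hcd⟩
    have := hu (⟨c, hc⟩, ⟨d, hd⟩) hcd
    simpa using this

/-- The set of translation vectors of a lattice tiling: a lattice `Λ` in `ℤⁿ` (a subgroup of full
rank, that is, of finite index), up to the choice of the origin. In particular, if `0 ∈ L`, then
`L = Λ` is a lattice itself. -/
def IsLatticeUpToTranslation {n : ℕ} (L : Set (Fin n → ℤ)) : Prop :=
  ∃ Λ : AddSubgroup (Fin n → ℤ), Λ.FiniteIndex ∧ ∃ a : Fin n → ℤ, L = a +ᵥ (Λ : Set (Fin n → ℤ))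

/-- A lattice up to translation that contains the origin is a lattice. -/
theorem IsLatticeUpToTranslation.eq_coe_of_zero_mem {n : ℕ} {L : Set (Fin n → ℤ)}
    (h : IsLatticeUpToTranslation L) (h0 : 0 ∈ L) :
    ∃ Λ : AddSubgroup (Fin n → ℤ), Λ.FiniteIndex ∧ L = (Λ : Set (Fin n → ℤ)) := by
  obtain ⟨Λ, hΛ, a, rfl⟩ := h
  refine ⟨Λ, hΛ, ?_⟩
  have ha : a ∈ Λ := by
    rw [Set.mem_vadd_set_iff_neg_vadd_mem] at h0
    simpa using h0
  ext x
  rw [Set.mem_vadd_set_iff_neg_vadd_mem, vadd_eq_add, SetLike.mem_coe, SetLike.mem_coe,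
    Λ.add_mem_cancel_left (Λ.neg_mem ha)]

/-! In the group algebra over `ZMod p`, `(∑ [v i]) ^ p = ∑ [p • v i]`. Hence `r • V` tiles with the
same `L` for `r` prime to `q` (`IsIndexedTiling.nsmul`), while `p = q` makes `L` invariant under `q
• G` (`add_card_nsmul_mem_iff`). Consequently every line in a direction `v k` meets `L` in one
residue class modulo `q`, its height `F`, and `L` is the zero set of `F : G → ZMod q`. On a line in
another direction `v i`, both `F` and `F` minus the parameter are injective modulo `q`. For `q ≤ 5`
such functions are affine. For `q = 7` a non-affine one does not extend to a plane spanned by two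
directions, by exhaustive search. Affinity on lines forces constant slopes (`slope_eq`), so `F - F
0` is a homomorphism and `L` is a coset of its kernel. -/

/-! ### Finite search for height functions on lines and planes modulo `q`. -/

/-- Values `v` and `w` of an integer-valued function modulo `q` at the points `c` and `d` of the
plane do not differ in a direction that a slice of a tiling avoids. -/
def sliceCompatible (q : ℕ) (c d : ℕ × ℕ) (v w : ℕ) : Bool :=
  bif c.1 % q == d.1 % q then
    c.2 % q == d.2 % q || (v != w && (v + d.2) % q != (w + c.2) % q)
  else bif c.2 % q == d.2 % q then v != w && (v + d.1) % q != (w + c.1) % q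
  else bif (c.1 + c.2) % q == (d.1 + d.2) % q then v != w
  else true

/-- Backtracking search: `leaf` holds for each extension of a partial function to `cs` that respects
`sliceCompatible`. -/
def sliceSearch (q : ℕ) (leaf : List ((ℕ × ℕ) × ℕ) → Bool) :
    List (ℕ × ℕ) → List ((ℕ × ℕ) × ℕ) → Bool
  | [], a => leaf a
  | c :: cs, a => (List.range q).all fun v =>
      bif a.all fun d => sliceCompatible q c d.1 v d.2 then sliceSearch q leaf cs ((c, v) :: a)
      else true

/-- The branch that follows the values of `f` itself is never pruned. -/
theorem sliceSearch_sound {q : ℕ} {f : ℕ × ℕ → ℕ} (hf : ∀ c, f c < q)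
    (hc : ∀ c d, sliceCompatible q c d (f c) (f d)) {leaf : List ((ℕ × ℕ) × ℕ) → Bool}
    (cs ds : List (ℕ × ℕ))
    (h : sliceSearch q leaf cs (ds.map fun c => (c, f c)) = true) :
    leaf ((cs.reverse ++ ds).map fun c => (c, f c)) = true := by
  induction cs generalizing ds with
  | nil => exact h
  | cons c cs ih =>
    rw [sliceSearch, List.all_eq_true] at h
    have h1 := h (f c) (List.mem_range.mpr (hf c))
    have h2 : ((ds.map fun c => (c, f c)).all fun d => sliceCompatible q c d.1 (f c) d.2) = true := by
      simp [hc]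
    rw [h2, cond_true] at h1
    simpa using ih (c :: ds) (by simpa using h1)

/-- The values of a partial function that vanishes at the origin are linear on its domain, if that is
part of the second coordinate axis. -/
def isSlopeConstant (q : ℕ) (a : List ((ℕ × ℕ) × ℕ)) : Bool :=
  a.all fun c => a.all fun d => d.1 != (0, 1) || c.2 == (c.1.2 * d.2) % q

/-- The points of the second coordinate axis other than the origin. -/
def axisPoints (q : ℕ) : List (ℕ × ℕ) := (List.range (q - 1)).map fun y => (0, y + 1)

/-- The points off the second coordinate axis. -/
def offAxisPoints (q : ℕ) : List (ℕ × ℕ) :=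
  (List.range q).flatMap fun y => (List.range (q - 1)).map fun x => (x + 1, y)

theorem sliceSearch_five : sliceSearch 5 (isSlopeConstant 5) (axisPoints 5) [((0, 0), 0)] := by
  decide +kernel

/-- Modulo 7 the axis alone admits nonlinear solutions; the inner search shows that none of them
extends to the plane. -/
theorem sliceSearch_seven :
    sliceSearch 7 (fun a => isSlopeConstant 7 a || sliceSearch 7 (fun _ => false) (offAxisPoints 7) a)
      (axisPoints 7) [((0, 0), 0)] := by
  decide +kernel

/-- The translates of `L` by the members of the family `v` partition the group. -/
def IsIndexedTiling {G ι : Type*} [AddCommGroup G] (v : ι → G) (L : Set G) : Prop :=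
  ∀ x, ∃! i, x - v i ∈ L

/-! ### Counting representations with the group algebra. -/

section Translation

variable {G : Type*} [AddCommGroup G]

/-- Translation of functions on a group, as a representation of the group. -/
def translationHom (R G : Type*) [CommRing R] [AddCommGroup G] :
    Multiplicative G →* Module.End R (G → R) where
  toFun g := LinearMap.funLeft R R fun x => x - g.toAdd
  map_one' := by ext f x; simp [LinearMap.funLeft_apply]
  map_mul' a b := by
    refine LinearMap.ext fun f => funext fun x => ?_
    simp only [LinearMap.funLeft_apply, Module.End.mul_apply, toAdd_mul]
    congr 1
    abel

theorem translationHom_apply (R : Type*) [CommRing R] (g : G) (f : G → R) (x : G) :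
    translationHom R G (Multiplicative.ofAdd g) f x = f (x - g) := rfl

variable {ι : Type*} [Fintype ι]

open Classical in
/-- Freshman's dream in the group algebra: counting representations modulo a prime. -/
theorem sum_translate_nsmul_eq (p : ℕ) [Fact p.Prime] (v : ι → G) (f : G → ZMod p)
    (hf : ∀ x, ∑ i, f (x - v i) = 1) (x : G) :
    ∑ i, f (x - p • v i) = (Fintype.card ι : ZMod p) ^ (p - 1) := by
  let φ := AddMonoidAlgebra.lift (ZMod p) (Module.End (ZMod p) (G → ZMod p)) G
    (translationHom (ZMod p) G)
  have hφ (w : ι → G) (h : G → ZMod p) (x : G) :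
      φ (∑ i, AddMonoidAlgebra.single (w i) 1) h x = ∑ i, h (x - w i) := by
    simp [φ, map_sum, LinearMap.sum_apply, Finset.sum_apply, translationHom_apply]
  let S : AddMonoidAlgebra (ZMod p) G := ∑ i, AddMonoidAlgebra.single (v i) 1
  have h1 : φ S f = 1 := funext fun x => (hφ v f x).trans (hf x)
  -- The first factor `S` turns `f` into the constant 1; each further factor multiplies a constant
  -- by the number of translates.
  have h2 (n : ℕ) : φ (S ^ (n + 1)) f = fun _ => (Fintype.card ι : ZMod p) ^ n := by
    induction n with
    | zero => rw [zero_add, pow_one, h1]; funext; simp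
    | succ n ih =>
      rw [pow_succ', map_mul, Module.End.mul_apply, ih]
      funext x
      rw [hφ]
      simp [pow_succ']
  have hp : 0 < p := (Fact.out : p.Prime).pos
  have h3 : S ^ p = ∑ i, AddMonoidAlgebra.single (p • v i) 1 := by
    have : CharP (AddMonoidAlgebra (ZMod p) G) p := charP_of_injective_algebraMap
      (algebraMap (ZMod p) (AddMonoidAlgebra (ZMod p) G)).injective p
    rw [sum_pow_char]
    simp [AddMonoidAlgebra.single_pow]
  rw [← hφ (fun i => p • v i) f x, ← h3]
  have := congrFun (h2 (p - 1)) x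
  rwa [Nat.sub_add_cancel hp] at this

end Translation

/-! ### Multiples of a tiling and periodicity. -/

namespace IsIndexedTiling

variable {G : Type*} [AddCommGroup G] {ι : Type*} [Fintype ι] {v : ι → G} {L : Set G}

open Classical in
theorem card_filter_eq_one (h : IsIndexedTiling v L) (x : G) :
    (Finset.univ.filter fun i => x - v i ∈ L).card = 1 := by
  obtain ⟨i, hi, hu⟩ := h x
  refine Finset.card_eq_one.mpr ⟨i, ?_⟩
  ext j
  simp only [Finset.mem_filter, Finset.mem_univ, true_and, Finset.mem_singleton]
  exact ⟨hu j, fun e => e ▸ hi⟩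

open Classical in
theorem card_filter_nsmul_cast (h : IsIndexedTiling v L) (p : ℕ) [Fact p.Prime] (x : G) :
    ((Finset.univ.filter fun i => x - p • v i ∈ L).card : ZMod p) =
      (Fintype.card ι : ZMod p) ^ (p - 1) := by
  rw [← sum_translate_nsmul_eq p v (fun y => if y ∈ L then 1 else 0) ?_ x]
  · simp
  · intro y
    simpa using congrArg (Nat.cast : ℕ → ZMod p) (h.card_filter_eq_one y)

open Classical in
theorem nsmul_prime (h : IsIndexedTiling v L) {p : ℕ} (hp : p.Prime)
    (hpq : p.Coprime (Fintype.card ι)) : IsIndexedTiling (fun i => p • v i) L := by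
  have : Fact p.Prime := ⟨hp⟩
  let N : G → ℕ := fun x => (Finset.univ.filter fun i => x - p • v i ∈ L).card
  -- By Fermat, `N x` is 1 modulo `p`, hence nonzero.
  have hN : ∀ x, 1 ≤ N x := by
    intro x
    rw [Nat.one_le_iff_ne_zero]
    intro h0
    have := h.card_filter_nsmul_cast p x
    change (N x : ZMod p) = _ at this
    rw [h0, ZMod.pow_card_sub_one_eq_one] at this
    · simp at this
    · rw [Ne, ZMod.natCast_eq_zero_iff]
      exact fun hd => hp.one_lt.ne' (Nat.Coprime.eq_one_of_dvd hpq hd)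
  -- Double counting with the original tiling: `N` has mean 1 over each such window, so the lower
  -- bound is an equality.
  have hsum (x : G) : ∑ j, N (x - v j) = Fintype.card ι := by
    simp only [N, Finset.card_filter]
    rw [Finset.sum_comm]
    have (i : ι) : ∑ j, (if x - v j - p • v i ∈ L then 1 else 0) = 1 := by
      rw [← Finset.card_filter, ← h.card_filter_eq_one (x - p • v i)]
      simp only [sub_right_comm]
    simp [this]
  have hN1 (x : G) : N x = 1 := by
    obtain ⟨j, -, -⟩ := h x
    have h1 : ∑ i : ι, 1 = ∑ i, N (x + v j - v i) := by rw [hsum]; simp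
    have := (Finset.sum_eq_sum_iff_of_le fun i _ => hN (x + v j - v i)).mp h1 j (Finset.mem_univ j)
    simpa using this.symm
  intro x
  obtain ⟨i, hi⟩ := Finset.card_eq_one.mp (hN1 x)
  simp only [Finset.ext_iff, Finset.mem_filter, Finset.mem_univ, true_and,
    Finset.mem_singleton] at hi
  exact ⟨i, (hi i).mpr rfl, fun j => (hi j).mp⟩

theorem nsmul (h : IsIndexedTiling v L) {r : ℕ} (hr : r.Coprime (Fintype.card ι)) (hr0 : r ≠ 0) :
    IsIndexedTiling (fun i => r • v i) L := by
  induction r using Nat.recOnMul generalizing v with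
  | zero => exact absurd rfl hr0
  | one => simpa using h
  | prime p hp => exact h.nsmul_prime hp hr
  | mul a b iha ihb =>
    have := ihb (iha h hr.coprime_mul_right (left_ne_zero_of_mul hr0)) hr.coprime_mul_left
      (right_ne_zero_of_mul hr0)
    simpa only [smul_smul, mul_comm] using this

open Classical in
-- For `p = q` the count is divisible by `q` and at most `q`, so it is all or nothing.
theorem sub_card_nsmul_mem (h : IsIndexedTiling v L) (hq : (Fintype.card ι).Prime) {x : G} {i : ι}
    (hx : x - Fintype.card ι • v i ∈ L) (j : ι) : x - Fintype.card ι • v j ∈ L := by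
  have : Fact (Fintype.card ι).Prime := ⟨hq⟩
  have h1 := h.card_filter_nsmul_cast (Fintype.card ι) x
  rw [ZMod.natCast_self, zero_pow (Nat.sub_ne_zero_of_lt hq.one_lt), ZMod.natCast_eq_zero_iff] at h1
  have h2 : (Finset.univ.filter fun i => x - Fintype.card ι • v i ∈ L).card = Fintype.card ι := by
    refine le_antisymm (Finset.card_le_univ _) (Nat.le_of_dvd (Finset.card_pos.mpr ⟨i, ?_⟩) h1)
    simpa using hx
  have h3 := Finset.mem_univ j
  rw [← (Finset.card_eq_iff_eq_univ _).mp h2] at h3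
  simpa using h3

theorem add_card_nsmul_mem_iff (h : IsIndexedTiling v L) (hq : (Fintype.card ι).Prime)
    {o : ι} (ho : v o = 0) (hgen : AddSubgroup.closure (Set.range v) = ⊤) (x y : G) :
    x + Fintype.card ι • y ∈ L ↔ x ∈ L := by
  have hy : y ∈ AddSubgroup.closure (Set.range v) := hgen ▸ AddSubgroup.mem_top y
  induction hy using AddSubgroup.closure_induction generalizing x with
  | mem y hy =>
    obtain ⟨i, rfl⟩ := hy
    constructor
    · intro hx
      have := h.sub_card_nsmul_mem hq (x := x + Fintype.card ι • v i) (i := o) (by simpa [ho]) i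
      simpa using this
    · intro hx
      have := h.sub_card_nsmul_mem hq (x := x + Fintype.card ι • v i) (i := i) (by simpa) o
      simpa [ho] using this
  | zero => simp
  | add y z _ _ hy hz => rw [smul_add, ← add_assoc]; exact (hz _).trans (hy x)
  | neg y _ hy =>
    refine (hy (x + Fintype.card ι • -y)).symm.trans ?_
    rw [smul_neg, neg_add_cancel_right]

/-- Two members of `L` do not differ by a multiple of a difference of two translation vectors. -/
theorem eq_of_mem (h : IsIndexedTiling v L) {r : ℕ} (hr : r.Coprime (Fintype.card ι)) (hr0 : r ≠ 0)
    {x : G} {i j : ι} (hi : x + r • v i ∈ L) (hj : x + r • v j ∈ L) : i = j := by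
  -- This point would be covered twice by the tiling with the multiples `r • v`.
  refine ((h.nsmul hr hr0) (x + r • v i + r • v j)).unique ?_ ?_
  · simpa [add_sub_right_comm] using hj
  · simpa using hi

end IsIndexedTiling

/-! ### The height function of a tiling. -/

namespace IsIndexedTiling

variable {G : Type*} [AddCommGroup G] {ι : Type*} [Fintype ι] {v : ι → G} {L : Set G}

theorem coprime_card_of_cast_ne_zero (hq : (Fintype.card ι).Prime) {r : ℕ}
    (hr : (r : ZMod (Fintype.card ι)) ≠ 0) : r.Coprime (Fintype.card ι) ∧ r ≠ 0 := by
  refine ⟨Nat.Coprime.symm ((Nat.Prime.coprime_iff_not_dvd hq).mpr ?_), ?_⟩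
  · rwa [← ZMod.natCast_eq_zero_iff]
  · rintro rfl
    simp at hr

/-- Each line in the direction of a translation vector meets `L`. -/
theorem exists_sub_nsmul_mem (h : IsIndexedTiling v L) (hq : (Fintype.card ι).Prime)
    {o : ι} (ho : v o = 0) {k : ι} (hk : k ≠ o) (x : G) : ∃ r : ℕ, x - r • v k ∈ L := by
  classical
  by_cases hx : x ∈ L
  · exact ⟨0, by simpa⟩
  have : Fact (Fintype.card ι).Prime := ⟨hq⟩
  -- Pigeonhole: each nonzero residue `r` selects an index other than `o`, injectively by
  -- `eq_of_mem`. Both sets have `q - 1` elements, so `k` is selected.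
  have key (r : {r : ZMod (Fintype.card ι) // r ≠ 0}) :
      ∃ i : {i : ι // i ≠ o}, x - r.1.val • v i ∈ L := by
    obtain ⟨h1, h2⟩ := coprime_card_of_cast_ne_zero hq (r := r.1.val) (by simpa using r.2)
    obtain ⟨i, hi, -⟩ := h.nsmul h1 h2 x
    refine ⟨⟨i, ?_⟩, hi⟩
    rintro rfl
    simp [ho, hx] at hi
  choose g hg using key
  have step (r s : {r : ZMod (Fintype.card ι) // r ≠ 0}) (hrs : g r = g s)
      (hlt : r.1.val < s.1.val) : False := by
    have hs := hg s
    rw [← hrs] at hs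
    have hlt2 := ZMod.val_lt s.1
    have hne : ((s.1.val - r.1.val : ℕ) : ZMod (Fintype.card ι)) ≠ 0 := by
      rw [Ne, ZMod.natCast_eq_zero_iff]
      intro hd
      have := Nat.le_of_dvd (by omega) hd
      omega
    obtain ⟨h1, h2⟩ := coprime_card_of_cast_ne_zero hq hne
    refine (g r).2 (h.eq_of_mem h1 h2 (x := x - s.1.val • v (g r)) (j := o) ?_ ?_)
    · convert hg r using 1
      rw [sub_nsmul _ hlt.le]
      abel
    · simpa [ho] using hs
  have hinj : Function.Injective g := by
    intro r s hrs
    rcases lt_trichotomy r.1.val s.1.val with hlt | heq | hlt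
    · exact (step r s hrs hlt).elim
    · exact Subtype.ext (ZMod.val_injective _ heq)
    · exact (step s r hrs.symm hlt).elim
  have hbij := (Fintype.bijective_iff_injective_and_card g).mpr ⟨hinj, by
    rw [Fintype.card_subtype_compl, Fintype.card_subtype_compl]; simp [ZMod.card]⟩
  obtain ⟨r, hr⟩ := hbij.2 ⟨k, hk⟩
  exact ⟨_, by simpa [hr] using hg r⟩

/-- The position of `L` on the lines in a direction `v k`, as a function modulo the number of
translation vectors. -/
theorem exists_height (h : IsIndexedTiling v L) (hq : (Fintype.card ι).Prime)
    {o : ι} (ho : v o = 0) (hgen : AddSubgroup.closure (Set.range v) = ⊤) {k : ι} (hk : k ≠ o) :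
    ∃ F : G → ZMod (Fintype.card ι), ∀ x (r : ℕ), x - r • v k ∈ L ↔ (r : ZMod _) = F x := by
  have : Fact (Fintype.card ι).Prime := ⟨hq⟩
  choose r hr using h.exists_sub_nsmul_mem hq ho hk
  have hper (x : G) (a b : ℕ) (hab : (a : ZMod (Fintype.card ι)) = b) (ha : x - a • v k ∈ L) :
      x - b • v k ∈ L := by
    obtain ⟨c, hc⟩ := (ZMod.intCast_eq_intCast_iff_dvd_sub b a (Fintype.card ι)).mp
      (by exact_mod_cast hab.symm)
    rw [← h.add_card_nsmul_mem_iff hq ho hgen _ (-(c • v k))]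
    convert ha using 1
    have : a • v k = b • v k + Fintype.card ι • c • v k := by
      rw [← natCast_zsmul, ← natCast_zsmul (v k) b, ← natCast_zsmul (c • v k), smul_smul, ← add_smul,
        ← hc]
      simp
    rw [this, smul_neg]
    abel
  have hlt (x : G) (a b : ℕ) (ha : x - a • v k ∈ L) (hb : x - b • v k ∈ L) (hab : a < b) :
      (a : ZMod (Fintype.card ι)) = b := by
    by_contra hne
    obtain ⟨h1, h2⟩ := coprime_card_of_cast_ne_zero hq (r := b - a)
      (by rw [Nat.cast_sub hab.le, sub_ne_zero]; exact Ne.symm hne)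
    refine hk (h.eq_of_mem h1 h2 (x := x - b • v k) (j := o) ?_ (by simpa [ho]))
    convert ha using 1
    rw [sub_nsmul _ hab.le]
    abel
  refine ⟨fun x => r x, fun x s => ⟨fun hs => ?_, fun hs => hper x _ _ hs.symm (hr x)⟩⟩
  rcases lt_trichotomy s (r x) with hl | he | hl
  · exact hlt x _ _ hs (hr x) hl
  · rw [he]
  · exact (hlt x _ _ (hr x) hs hl).symm

end IsIndexedTiling

/-- A function describing the heights of a tiling above the span of the vectors other than `v k`:
the zero set of `F` is the set of translations. -/
structure IsHeight {G ι : Type*} [AddCommGroup G] (q : ℕ) (v : ι → G) (o k : ι)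
    (F : G → ZMod q) : Prop where
  zero : v o = 0
  ne : k ≠ o
  add_nsmul (x : G) (r : ℕ) : F (x + r • v k) = F x + r
  add_ne (x : G) (r : ℕ) (i : ι) : (r : ZMod q) ≠ 0 → i ≠ o → i ≠ k → F (x + r • v i) ≠ F x
  add_ne_add (x : G) (r : ℕ) (i : ι) : (r : ZMod q) ≠ 0 → i ≠ k → F (x + r • v i) ≠ F x + r
  add_ne_of_ne (x : G) (r : ℕ) (i j : ι) : (r : ZMod q) ≠ 0 → i ≠ j →
    F (x + r • v i) ≠ F (x + r • v j)
  add_card (x y : G) : F (x + q • y) = F x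

theorem IsIndexedTiling.exists_isHeight {G : Type*} [AddCommGroup G] {ι : Type*} [Fintype ι]
    {v : ι → G} {L : Set G} (h : IsIndexedTiling v L) (hq : (Fintype.card ι).Prime)
    {o : ι} (ho : v o = 0) (hgen : AddSubgroup.closure (Set.range v) = ⊤) {k : ι} (hk : k ≠ o) :
    ∃ F : G → ZMod (Fintype.card ι), IsHeight _ v o k F ∧ ∀ x, x ∈ L ↔ F x = 0 := by
  have : Fact (Fintype.card ι).Prime := ⟨hq⟩
  obtain ⟨F, hF⟩ := h.exists_height hq ho hgen hk
  have hval (x : G) : x - (F x).val • v k ∈ L := (hF x _).mpr (by simp)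
  have hadd (x : G) (r : ℕ) : F (x + r • v k) = F x + r := by
    rw [eq_comm]
    have := (hF (x + r • v k) ((F x).val + r)).mp
      (by rw [add_nsmul, add_sub_add_right_eq_sub]; exact hval x)
    simpa using this
  -- With equal heights, lowering both points along `v k` gives two members of `L` that `eq_of_mem`
  -- forbids. The cases `j = o` and `j = k` yield `add_ne` and `add_ne_add`.
  have hne (x : G) (r : ℕ) (i j : ι) (hr : (r : ZMod (Fintype.card ι)) ≠ 0) (hij : i ≠ j) :
      F (x + r • v i) ≠ F (x + r • v j) := by
    intro he
    obtain ⟨h1, h2⟩ := IsIndexedTiling.coprime_card_of_cast_ne_zero hq hr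
    have hi := hval (x + r • v i)
    have hj := hval (x + r • v j)
    rw [← he] at hj
    rw [add_sub_right_comm] at hi hj
    exact hij (h.eq_of_mem h1 h2 hi hj)
  refine ⟨F, ⟨ho, hk, hadd, ?_, ?_, hne, ?_⟩, fun x => ?_⟩
  · intro x r i hr hi _
    simpa [ho] using hne x r i o hr hi
  · intro x r i hr hi
    rw [← hadd]
    exact hne x r i k hr hi
  · intro x y
    rw [eq_comm]
    have := (hF (x + Fintype.card ι • y) (F x).val).mp
      (by rw [add_sub_right_comm, h.add_card_nsmul_mem_iff hq ho hgen]; exact hval x)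
    simpa using this
  · simpa [eq_comm] using hF x 0

/-! ### Affinity of height functions. -/

namespace IsHeight

variable {G ι : Type*} [AddCommGroup G] {q : ℕ} {v : ι → G} {o k : ι} {F : G → ZMod q}

theorem eq_of_cast_eq (h : IsHeight q v o k F) {a b : ℕ} (hab : (a : ZMod q) = b) (x y : G) :
    F (x + a • y) = F (x + b • y) := by
  obtain ⟨c, hc⟩ := (ZMod.intCast_eq_intCast_iff_dvd_sub b a q).mp (by exact_mod_cast hab.symm)
  rw [← h.add_card (x + b • y) (c • y), add_assoc]
  congr 2
  rw [← natCast_zsmul, ← natCast_zsmul y b, ← natCast_zsmul (c • y), smul_smul, ← add_smul, ← hc]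
  simp

theorem ne_of_cast_ne [NeZero q] (h : IsHeight q v o k F) {i : ι} (hio : i ≠ o) (hik : i ≠ k)
    {a b : ℕ} (hab : (a : ZMod q) ≠ b) (x : G) :
    F (x + a • v i) ≠ F (x + b • v i) ∧ F (x + a • v i) + b ≠ F (x + b • v i) + a := by
  have hr : (((a : ZMod q) - b).val : ZMod q) = a - b := ZMod.natCast_zmod_val _
  have h0 : (((a : ZMod q) - b).val : ZMod q) ≠ 0 := by rwa [hr, sub_ne_zero]
  have key : F (x + a • v i) = F (x + b • v i + ((a : ZMod q) - b).val • v i) := by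
    rw [add_assoc, ← _root_.add_nsmul]
    exact h.eq_of_cast_eq (by simp) _ _
  rw [key]
  refine ⟨h.add_ne _ _ i h0 hio hik, fun he => h.add_ne_add (x + b • v i) _ i h0 hik ?_⟩
  rw [hr]
  linear_combination he

/-- Modulo `q`, both points arise from the corner `(c, b)` by moving `a - c` steps, one along `v j`
and the other along `v i`. -/
theorem ne_of_add_cast_eq [NeZero q] (h : IsHeight q v o k F) {i j : ι} (hij : i ≠ j)
    {a b c d : ℕ} (hac : (a : ZMod q) ≠ c) (hs : ((a + b : ℕ) : ZMod q) = (c + d : ℕ)) (x : G) :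
    F (x + (a • v j + b • v i)) ≠ F (x + (c • v j + d • v i)) := by
  have hr : (((a : ZMod q) - c).val : ZMod q) = a - c := ZMod.natCast_zmod_val _
  have h0 : (((a : ZMod q) - c).val : ZMod q) ≠ 0 := by rwa [hr, sub_ne_zero]
  have h1 : F (x + (a • v j + b • v i)) =
      F (x + (c • v j + b • v i) + ((a : ZMod q) - c).val • v j) := by
    have := h.eq_of_cast_eq (a := a) (b := c + ((a : ZMod q) - c).val) (by simp) (x + b • v i) (v j)
    rw [_root_.add_nsmul] at this
    convert this using 2 <;> abel
  have h2 : F (x + (c • v j + d • v i)) =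
      F (x + (c • v j + b • v i) + ((a : ZMod q) - c).val • v i) := by
    have := h.eq_of_cast_eq (a := d) (b := b + ((a : ZMod q) - c).val)
      (by push_cast at hs ⊢; rw [hr]; linear_combination -hs) (x + c • v j) (v i)
    rw [_root_.add_nsmul] at this
    convert this using 2 <;> abel
  rw [h1, h2]
  exact h.add_ne_of_ne _ _ _ _ h0 hij.symm

/-- The slices of a height function satisfy the constraints of the backtracking search. -/
theorem sliceCompatible [NeZero q] (h : IsHeight q v o k F) {i j : ι} (hio : i ≠ o) (hik : i ≠ k)
    (hjo : j ≠ o) (hjk : j ≠ k) (hij : i ≠ j) (x : G) (c d : ℕ × ℕ) :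
    _root_.sliceCompatible q c d (F (x + (c.1 • v j + c.2 • v i)) - F x).val
      (F (x + (d.1 • v j + d.2 • v i)) - F x).val := by
  have hval {y z : G} (hyz : F y ≠ F z) : ((F y - F x).val != (F z - F x).val) = true := by
    rw [bne_iff_ne]
    exact fun he => hyz (by simpa using ZMod.val_injective _ he)
  have hval' {y z : G} {a b : ℕ} (hyz : F y + b ≠ F z + a) :
      (((F y - F x).val + b) % q != ((F z - F x).val + a) % q) = true := by
    rw [bne_iff_ne]
    intro he
    have := (ZMod.natCast_eq_natCast_iff' _ _ _).mpr he
    push_cast [ZMod.natCast_zmod_val] at this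
    exact hyz (by linear_combination this)
  obtain ⟨c1, c2⟩ := c
  obtain ⟨d1, d2⟩ := d
  simp only [_root_.sliceCompatible, Bool.cond_eq_ite, beq_iff_eq]
  simp only [← ZMod.natCast_eq_natCast_iff' _ _ q]
  split_ifs with h1 h2 h3
  · rw [Bool.or_eq_true, beq_iff_eq, ← ZMod.natCast_eq_natCast_iff' _ _ q, or_iff_not_imp_left]
    intro h2
    have e : F (x + (c1 • v j + c2 • v i)) = F (x + d1 • v j + c2 • v i) := by
      rw [add_comm (c1 • _), ← add_assoc, h.eq_of_cast_eq h1, add_right_comm]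
    have := h.ne_of_cast_ne hio hik h2 (x + d1 • v j)
    rw [← e, add_assoc] at this
    rw [Bool.and_eq_true]
    exact ⟨hval this.1, hval' this.2⟩
  · have e : F (x + (c1 • v j + c2 • v i)) = F (x + d2 • v i + c1 • v j) := by
      rw [← add_assoc, h.eq_of_cast_eq h2, add_right_comm]
    have := h.ne_of_cast_ne hjo hjk h1 (x + d2 • v i)
    rw [← e, add_right_comm, add_assoc] at this
    rw [Bool.and_eq_true]
    exact ⟨hval this.1, hval' this.2⟩
  · exact hval (h.ne_of_add_cast_eq hij h1 h3 x)
  · rfl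

theorem slope_of_isSlopeConstant [NeZero q] {f : ℕ × ℕ → ZMod q} (h0 : f (0, 0) = 0)
    (h : isSlopeConstant q (((axisPoints q).reverse ++ [(0, 0)]).map fun c => (c, (f c).val)))
    (t : ℕ) (ht : t < q) : f (0, t) = t * f (0, 1) := by
  rcases Nat.eq_zero_or_pos t with rfl | htp
  · simpa
  have hmem (s : ℕ) (hs : 0 < s) (hsq : s < q) : (0, s) ∈ (axisPoints q).reverse ++ [(0, 0)] := by
    simp only [axisPoints, List.mem_append, List.mem_reverse, List.mem_map, List.mem_range]
    exact Or.inl ⟨s - 1, by omega, by rw [Nat.sub_add_cancel hs]⟩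
  simp only [isSlopeConstant, List.all_eq_true, List.forall_mem_map] at h
  have := h _ (hmem t htp ht) _ (hmem 1 one_pos (by omega))
  simp only [bne_self_eq_false, Bool.false_or, beq_iff_eq] at this
  have := congrArg (Nat.cast : ℕ → ZMod q) this
  simpa [ZMod.natCast_zmod_val] using this

/-- For at most seven translation vectors, height functions are affine on each line. -/
theorem add_nsmul_eq [Fintype ι] (h : IsHeight q v o k F) (hcard : Fintype.card ι = q)
    (hq : q.Prime) (hq7 : q ≤ 7) {i : ι} (hio : i ≠ o) (hik : i ≠ k) (x : G) (t : ℕ) :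
    F (x + t • v i) = F x + t * (F (x + v i) - F x) := by
  classical
  have : NeZero q := ⟨hq.ne_zero⟩
  suffices H : ∀ t < q, F (x + t • v i) - F x = t * (F (x + v i) - F x) by
    have h1 : ((t : ZMod q).val : ZMod q) = t := ZMod.natCast_zmod_val _
    have h2 := H (t : ZMod q).val (ZMod.val_lt _)
    rw [h1, h.eq_of_cast_eq h1] at h2
    linear_combination h2
  have hex (hq4 : 4 ≤ q) : ∃ j, j ≠ o ∧ j ≠ k ∧ i ≠ j := by
    have : ({o, k, i} : Finset ι).card < (Finset.univ : Finset ι).card := by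
      rw [Finset.card_univ, hcard]
      exact Finset.card_le_three.trans_lt hq4
    obtain ⟨j, -, hj⟩ := Finset.exists_mem_notMem_of_card_lt_card this
    simp only [Finset.mem_insert, Finset.mem_singleton, not_or] at hj
    exact ⟨j, hj.1, hj.2.1, Ne.symm hj.2.2⟩
  have hdeg : q = 2 ∨ q = 3 ∨ q = 5 ∨ q = 7 := by
    have := hq.two_le
    interval_cases q <;> first | omega | (exfalso; revert hq; decide)
  rcases hdeg with rfl | rfl | rfl | rfl
  -- For `q = 2` there is no third index `i`.
  · have := Finset.card_le_univ ({o, k, i} : Finset ι)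
    rw [hcard, Finset.card_insert_of_notMem, Finset.card_pair hik.symm] at this
    · omega
    · simp [h.ne.symm, hio.symm]
  · have h1 := h.ne_of_cast_ne hio hik (a := 0) (b := 1) (by decide) x
    have h2 := h.ne_of_cast_ne hio hik (a := 0) (b := 2) (by decide) x
    have h3 := h.ne_of_cast_ne hio hik (a := 1) (b := 2) (by decide) x
    simp only [zero_nsmul, add_zero, one_nsmul] at h1 h2 h3
    intro t ht
    interval_cases t
    · simp
    · simp
    · generalize F x = a, F (x + v i) = b, F (x + 2 • v i) = c at *
      revert a b c
      decide
  all_goals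
    obtain ⟨j, hjo, hjk, hij⟩ := hex (by norm_num)
    let f : ℕ × ℕ → ZMod _ := fun c => F (x + (c.1 • v j + c.2 • v i)) - F x
    have hf0 : f (0, 0) = 0 := by simp [f]
    have hf (t : ℕ) : f (0, t) = F (x + t • v i) - F x := by simp [f]
    have hlt (c : ℕ × ℕ) : (f c).val < _ := ZMod.val_lt _
    have hcompat := h.sliceCompatible hio hik hjo hjk hij x
  · have hs := sliceSearch_sound hlt hcompat (axisPoints 5) [(0, 0)]
      (by simpa [hf0] using sliceSearch_five)
    intro t ht
    simpa [hf] using slope_of_isSlopeConstant hf0 hs t ht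
  · have hs := sliceSearch_sound hlt hcompat (axisPoints 7) [(0, 0)]
      (by simpa [hf0] using sliceSearch_seven)
    rw [Bool.or_eq_true] at hs
    intro t ht
    refine hs.elim (fun hs => by simpa [hf] using slope_of_isSlopeConstant hf0 hs t ht) fun hs => ?_
    -- The leaf is constantly `false`, so an actual slice contradicts the search.
    simpa using sliceSearch_sound hlt hcompat _ _ hs

/-- The slopes of a height function do not depend on the base point. -/
theorem slope_eq [Fintype ι] (h : IsHeight q v o k F) (hcard : Fintype.card ι = q)
    (hq : q.Prime) (hq7 : q ≤ 7) (i j : ι) (x : G) :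
    F (x + v j + v i) - F (x + v j) = F (x + v i) - F x := by
  have : Fact q.Prime := ⟨hq⟩
  have hk (x : G) : F (x + v k) = F x + 1 := by simpa using h.add_nsmul x 1
  rcases eq_or_ne i o with rfl | hio
  · simp [h.zero]
  rcases eq_or_ne j o with rfl | hjo
  · simp [h.zero]
  rcases eq_or_ne i k with rfl | hik
  · simp [hk]
  rcases eq_or_ne j k with rfl | hjk
  · rw [add_right_comm, hk, hk]
    ring
  by_contra hne
  have hd : F (x + v i + v j) - F (x + v i) - (F (x + v j) - F x) ≠ 0 := by
    rw [add_right_comm x (v i)]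
    intro h0
    exact hne (by linear_combination h0)
  set d := F (x + v i + v j) - F (x + v i) - (F (x + v j) - F x) with hdd
  -- The increment along `v i` changes by `d` with each step along `v j`; after `s` steps it
  -- vanishes, against `add_ne`.
  let s : ℕ := (-(F (x + v i) - F x) / d).val
  have hs : (s : ZMod q) * d = -(F (x + v i) - F x) := by
    rw [ZMod.natCast_zmod_val, div_mul_cancel₀ _ hd]
  have h1 := h.add_nsmul_eq hcard hq hq7 hjo hjk (x + v i) s
  have h2 := h.add_nsmul_eq hcard hq hq7 hjo hjk x s
  refine h.add_ne (x + s • v j) 1 i (by simp) hio hik ?_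
  rw [one_nsmul, add_right_comm, h1, h2]
  linear_combination hs + (s : ZMod q) * hdd.symm

/-- Generation is used twice: the increment along each `v i` is the same at all base points, and
then additivity extends from the generators to all `y`. -/
theorem add_eq [Fintype ι] (h : IsHeight q v o k F) (hcard : Fintype.card ι = q)
    (hq : q.Prime) (hq7 : q ≤ 7) (hgen : AddSubgroup.closure (Set.range v) = ⊤) (x y : G) :
    F (x + y) - F 0 = F x - F 0 + (F y - F 0) := by
  have hslope (i : ι) (y x : G) : F (x + y + v i) - F (x + y) = F (x + v i) - F x := by
    have hy : y ∈ AddSubgroup.closure (Set.range v) := hgen ▸ AddSubgroup.mem_top y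
    induction hy using AddSubgroup.closure_induction generalizing x with
    | mem y hy =>
      obtain ⟨j, rfl⟩ := hy
      exact h.slope_eq hcard hq hq7 i j x
    | zero => simp
    | add y z _ _ hy hz => rw [← add_assoc]; exact (hz _).trans (hy x)
    | neg y _ hy => rw [← hy (x + -y), neg_add_cancel_right]
  have hy : y ∈ AddSubgroup.closure (Set.range v) := hgen ▸ AddSubgroup.mem_top y
  induction hy using AddSubgroup.closure_induction generalizing x with
  | mem y hy =>
    obtain ⟨i, rfl⟩ := hy
    have := hslope i x 0
    rw [zero_add, zero_add] at this
    linear_combination this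
  | zero => simp
  | add y z _ _ hy hz =>
    have h1 := hz (x + y)
    have h2 := hz y
    have h3 := hy x
    rw [← add_assoc]
    linear_combination h1 - h2 + h3
  | neg y _ hy =>
    have h1 := hy (x + -y)
    have h2 := hy (-y)
    rw [neg_add_cancel_right] at h1
    rw [neg_add_cancel] at h2
    linear_combination h2 - h1

end IsHeight

/-! ### The tiling set as a coset of a kernel. -/

theorem IsIndexedTiling.exists_eq_vadd {G : Type*} [AddCommGroup G] {ι : Type*} [Fintype ι]
    {v : ι → G} {L : Set G} (h : IsIndexedTiling v L) (hq : (Fintype.card ι).Prime)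
    (hq7 : Fintype.card ι ≤ 7) {o : ι} (ho : v o = 0)
    (hgen : AddSubgroup.closure (Set.range v) = ⊤) :
    ∃ Λ : AddSubgroup G, Λ.FiniteIndex ∧ ∃ a : G, L = a +ᵥ (Λ : Set G) := by
  have : Fact (Fintype.card ι).Prime := ⟨hq⟩
  have : Nontrivial ι := Fintype.one_lt_card_iff_nontrivial.mp hq.one_lt
  obtain ⟨k, hk⟩ := exists_ne o
  obtain ⟨F, hF, hL⟩ := h.exists_isHeight hq ho hgen hk
  let φ : G →+ ZMod (Fintype.card ι) :=
    AddMonoidHom.mk' (fun x => F x - F 0) (hF.add_eq rfl hq hq7 hgen)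
  obtain ⟨i, hi, -⟩ := h 0
  -- The index is finite because `φ` maps to a finite group; the base point is the member of `L`
  -- from the tile covering 0.
  refine ⟨φ.ker, inferInstance, 0 - v i, ?_⟩
  ext x
  have ha : φ (0 - v i) = - F 0 := by
    rw [AddMonoidHom.mk'_apply, (hL _).mp hi, zero_sub]
  rw [Set.mem_vadd_set_iff_neg_vadd_mem, SetLike.mem_coe, AddMonoidHom.mem_ker, vadd_eq_add, map_add,
    map_neg, ha, hL]
  simp [φ]

theorem mainTheorem4 (n q : ℕ) (hq : q.Prime) (hq7 : q ≤ 7)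
    (V : Finset (Fin n → ℤ)) (h0 : (0 : Fin n → ℤ) ∈ V) (hcard : V.card = q)
    (hgen : AddSubgroup.closure ((V : Set (Fin n → ℤ)) \ {0}) = ⊤)
    (L : Set (Fin n → ℤ)) (hL : IsTranslationTiling (V : Set (Fin n → ℤ)) L) :
    IsLatticeUpToTranslation L := by
  have hV : Fintype.card V = q := by rw [Fintype.card_coe, hcard]
  have hT : IsIndexedTiling (fun i : V => (i : Fin n → ℤ)) L := by
    intro x
    obtain ⟨p, ⟨h1, h2, h3⟩, hu⟩ := hL x
    refine ⟨⟨p.1, h1⟩, ?_, fun i hi => Subtype.ext ?_⟩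
    · simpa [← h3] using h2
    · exact congrArg Prod.fst (hu (i, x - i) ⟨i.2, hi, add_sub_cancel _ _⟩)
  refine hT.exists_eq_vadd (hV ▸ hq) (hV ▸ hq7) (o := ⟨0, h0⟩) rfl ?_
  rw [eq_top_iff, ← hgen]
  refine AddSubgroup.closure_mono fun x hx => ?_
  simpa using hx.1
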